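/- **Setting.** Let $\mathcal X$ be a finite set with $|\mathcal X|=N$ and let $\Delta_{\mathcal X}$ be the set of probability distributions on $\mathcal X$, written as vectors. For $q\in\Delta_{\mathcal X}$ and $B\subseteq\mathcal X$ put $q(B)=\sum_{x\in B}q_x$, and for $t\in[0,1]$ put $B_t=B_t(q)=\{x: q_x=t\}$. A distribution $q$ belongs to $\mathcal C(p,\alpha_1,\alpha_2)$ (is $(\alpha_1,\alpha_2)$-approximately calibrated with respect to $p$) if there is a set $T\subseteq[0,1]$ such that $(1-\alpha_1)p(B_t)\le q(B_t)\le(1+\alpha_1)p(B_t)$ for all $t\in[0,1]\setminus T$, $q(B_t)\ge(1-\alpha_1)p(B_t)$ for all $t\in T$, and $q\big(\bigcup_{t\in T}B_t\big)\le\alpha_2$. For a loss function $\ell:\Delta_{\mathcal X}\times\mathcal X\to\mathbb R$ write $\ell(q;p)=\sum_x p_x\,\ell(q,x)$. A function $f$ is $b(z)$-left-strongly concave if for every $z\ge 1$ and all $y,y'\in[1,z]$, $f(y)\le f(y')+f'(y')(y-y')-\frac{b(z)}2(y-y')^2$. **Theorem.** There is a universal constant $c_1>0$ with the following property. Let $\ell$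 be a local loss function with $\ell(q,x)=f(1/q_x)$ (whenever $q_x>0$), where $f$ is nonnegative, nondecreasing, concave and differentiable on $[1,\infty)$. Suppose that $f(z)\le c\sqrt z$ for all $z\ge1$ and some constant $c$; that $f'(z)\le D(z)/z$ for all $z\ge 1$ and some nondecreasing function $D$ on $[1,\infty)$; and that $f$ is $\frac{C(z)}{z^2}$-left-strongly concave, where $C$ is nonincreasing and nonnegative on $[1,\infty)$. Let $p\in\Delta_{\mathcal X}$ and $q\in\mathcal C(p,\alpha_1,\alpha_2)$, where $\alpha_2>0$, $\alpha_1,\alpha_2\le\frac{\|p-q\|_1^2}{12}$ and $C\!\left(\frac{2N}{\alpha_2}\right)>0$. Let $0<\delta\le1$, $$\beta=\frac{576\,N^8}{\delta\cdot\min\!\left(1,\left[C\!\left(\frac{2N}{\alpha_2}\right)\cdot\frac{\|p-q\|_1^2}{128\,c}\right]^2\right)},$$ and let $\hat p$ be the empirical distribution of $m$ independent samples from $p$, where $m\le N$ and $$m\ \ge\ \frac{c_1\, f(\beta)^2\,\ln\frac1\delta}{\left(C\!\left(\frac{N}{2\alpha_2}\right)\|p-q\|_1^2\right)^2}.$$ Then,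 with probability at least $1-\delta$, $$\ell(q;\hat p)-\ell(p;\hat p)\;>\;C\!\left(\frac{N}{2\alpha_2}\right)\cdot\frac{\|p-q\|_1^2}{384}\;-\;2\alpha_1 D\!\left(\frac{N}{2\alpha_2}\right)\;-\;3\alpha_2 f\!\left(\frac{N}{3\alpha_2}\right).$$ -/

import Mathlib

open Set MeasureTheory ProbabilityTheory

universe u v

namespace LossDist

/-- The `ℓ₁` distance between two vectors indexed by a finite domain. -/
def l1Dist {X : Type u} [Fintype X] (p q : X → ℝ) : ℝ := ∑ x, |p x - q x|

open Classical in
/-- The mass `q(B)` that a vector of probabilities `q` places on a set `B`. -/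
noncomputable def mass {X : Type u} [Fintype X] (q : X → ℝ) (B : Set X) : ℝ :=
  ∑ x, if x ∈ B then q x else 0

/-- The bucket `B_t(q) = {x : q_x = t}`. -/
def bucket {X : Type u} (q : X → ℝ) (t : ℝ) : Set X := {x | q x = t}

/-- `q` is `(α₁, α₂)`-approximately calibrated with respect to `p`: for some set `T ⊆ [0,1]` of
levels, `q(B_t) ∈ (1 ± α₁) p(B_t)` for levels outside `T`, `q(B_t) ≥ (1 - α₁) p(B_t)` for levels
in `T`, and the buckets with level in `T` have total `q`-mass at most `α₂`. -/
def ApproxCalibrated {X : Type u} [Fintype X] (p : X → ℝ) (α₁ α₂ : ℝ) (q : X → ℝ) : Prop :=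
  ∃ T : Set ℝ, T ⊆ Icc 0 1 ∧
    (∀ t ∈ Icc (0 : ℝ) 1 \ T,
      (1 - α₁) * mass p (bucket q t) ≤ mass q (bucket q t) ∧
      mass q (bucket q t) ≤ (1 + α₁) * mass p (bucket q t)) ∧
    (∀ t ∈ T, (1 - α₁) * mass p (bucket q t) ≤ mass q (bucket q t)) ∧
    mass q (⋃ t ∈ T, bucket q t) ≤ α₂

/-- The set `𝒞(p, α₁, α₂)` of all distributions that are `(α₁, α₂)`-approximately calibrated
with respect to `p`. -/
def approxCalibratedSet {X : Type u} [Fintype X] (p : X → ℝ) (α₁ α₂ : ℝ) : Set (X → ℝ) :=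
  {q | q ∈ stdSimplex ℝ X ∧ ApproxCalibrated p α₁ α₂ q}

/-- `ℓ` is the local loss `ℓ(q, x) = f(1 / q_x)`. Its value where `q_x = 0` (where `1 / q_x` is
infinite) is left arbitrary. -/
def IsInverseLoss {X : Type u} [Fintype X] (ℓ : (X → ℝ) → X → ℝ) (f : ℝ → ℝ) : Prop :=
  ∀ q ∈ stdSimplex ℝ X, ∀ x, 0 < q x → ℓ q x = f (1 / q x)

/-- The expected loss `ℓ(q; p) = E_{X ∼ p} ℓ(q, X)`. -/
def expectedLoss {X : Type u} [Fintype X] (ℓ : (X → ℝ) → X → ℝ) (q p : X → ℝ) : ℝ :=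
  ∑ x, p x * ℓ q x

open Classical in
/-- The empirical distribution of the sample `s₁, …, s_m`. -/
noncomputable def empirical {X : Type u} {m : ℕ} (s : Fin m → X) : X → ℝ :=
  fun x => ((Finset.univ.filter fun i => s i = x).card : ℝ) / m

/-- `f`, as a function on the set `s`, is `b`-strongly concave (first-order form). -/
def StronglyConcaveOn (f : ℝ → ℝ) (s : Set ℝ) (b : ℝ) : Prop :=
  ∀ z ∈ s, ∀ z' ∈ s, f z ≤ f z' + derivWithin f s z' * (z - z') - b / 2 * (z - z') ^ 2

/-- `f` is `b(z)`-left-strongly concave: for every `z`, its restriction to the part of the domain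
to the left of `z` is `b(z)`-strongly concave. The domain is `[1, ∞)`, which is where the
arguments `1 / q_x` of `f` lie; asking for this on `[1, z]` is weaker than on `[0, z]`. -/
def LeftStronglyConcave (f b : ℝ → ℝ) : Prop :=
  ∀ z, 1 ≤ z → StronglyConcaveOn f (Icc 1 z) (b z)

/-- `S₁, …, S_m` are independent samples from the distribution `p`. -/
def IsIIDSample {X : Type u} [MeasurableSpace X] {Ω : Type v} [MeasurableSpace Ω]
    (P : Measure Ω) {m : ℕ} (S : Fin m → Ω → X) (p : X → ℝ) : Prop :=
  (∀ i, Measurable (S i)) ∧ iIndepFun S P ∧ ∀ i x, P.real (S i ⁻¹' {x}) = p x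

end LossDist

/-! The excess loss is a sample mean of `Y x = ℓ q x - ℓ p x`, so the theorem needs a lower bound on
its expectation under `p` and a concentration bound.

Expectation (`ApproxCalibrated.le_sum_mul_sub`). Multiplying the tangent inequality for `f` at `1 /
q x` by `p x` bounds each term below by `f'(1/q) / q * (p - q)`; where `q < p`, left strong
concavity adds `C(1/q) / 2 * (p - q)² / p`. The linear weight depends only on the level `q x`, so
calibration makes its sum almost nonnegative, at cost `α₁ D(E)` with `E = N / (2α₂)`; Cauchy–Schwarz
turns the quadratic terms into a multiple of `C(E) * l1Dist p q ^ 2`. This works where the level is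
unexceptional and `q ≥ 2α₂ / N`. The remaining points have `q`-mass below `3α₂`. Only those with `p
< q` can contribute negatively, and Jensen bounds their entropy-like sum by `3α₂ f(N / (3α₂))`.

Concentration. `Y` may be large where `p` is tiny, so points with `p < 2N / β` are discarded: the
growth `f z ≤ c √z` makes their contribution negligible, and `m ≤ N` makes it unlikely to sample
any. Elsewhere `|Y| ≤ f β`, and a Chernoff bound restricted to samples avoiding the discarded points
finishes. -/

namespace LossDist

/-! ### Pointwise consequences of concavity and Jensen's inequality -/

section Concave

variable {f C : ℝ → ℝ}

lemma le_add_derivWithin_mul_sub_of_concaveOn {s : Set ℝ} (hf : ConcaveOn ℝ s f)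
    (hd : DifferentiableOn ℝ f s) {y z : ℝ} (hy : y ∈ s) (hz : z ∈ s) :
    f y ≤ f z + derivWithin f s z * (y - z) := by
  rcases lt_trichotomy y z with h | h | h
  · have := hf.derivWithin_le_slope hy hz h (hd z hz)
    rw [slope_def_field, le_div_iff₀ (sub_pos.2 h)] at this
    linarith
  · simp [h]
  · have := hf.slope_le_derivWithin hz hy h (hd z hz)
    rw [slope_def_field, div_le_iff₀ (sub_pos.2 h)] at this
    linarith

/-- Strong concavity on `[1, z]` is phrased with the derivative within that interval. Strictness of
`1 < z` matters: for `z = 1` the interval is a point and derivatives within it are not unique. -/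
lemma derivWithin_Icc_one_right (hd : DifferentiableOn ℝ f (Ici 1)) {z : ℝ} (hz : 1 < z) :
    derivWithin f (Icc 1 z) z = derivWithin f (Ici 1) z :=
  ((hd z (mem_Ici.2 hz.le)).hasDerivWithinAt.mono Icc_subset_Ici_self).derivWithin
    (uniqueDiffOn_Icc hz z (right_mem_Icc.2 hz.le))

lemma LeftStronglyConcave.le_at_right (hs : LeftStronglyConcave f fun x => C x / x ^ 2)
    (hd : DifferentiableOn ℝ f (Ici 1)) {y z : ℝ} (hy : 1 ≤ y) (hyz : y ≤ z) (hz : 1 < z) :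
    f y ≤ f z + derivWithin f (Ici 1) z * (y - z) - C z / z ^ 2 / 2 * (y - z) ^ 2 := by
  have := hs z hz.le y ⟨hy, hyz⟩ z ⟨hz.le, le_rfl⟩
  rwa [derivWithin_Icc_one_right hd hz] at this

/-- A nonnegative nondecreasing left-strongly concave function is bounded below at `2`. -/
lemma LeftStronglyConcave.div_eight_le (hs : LeftStronglyConcave f fun x => C x / x ^ 2)
    (hd : DifferentiableOn ℝ f (Ici 1)) (hm : MonotoneOn f (Ici 1)) (h0 : 0 ≤ f 1) :
    C 2 / 8 ≤ f 2 := by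
  have h1 := hs.le_at_right hd le_rfl one_le_two one_lt_two
  have h2 : 0 ≤ derivWithin f (Ici 1) 2 := hm.derivWithin_nonneg
  linarith

/-- The excess loss at a point is at least its linearization in `1 / q`. -/
lemma linear_le_mul_sub (hf : ConcaveOn ℝ (Ici 1) f) (hd : DifferentiableOn ℝ f (Ici 1))
    (hm : MonotoneOn f (Ici 1)) {a b : ℝ} (ha : 0 ≤ a) (ha1 : a ≤ 1) (hb : 0 < b) (hb1 : b ≤ 1) :
    derivWithin f (Ici 1) (1 / b) / b * (a - b) ≤ a * (f (1 / b) - f (1 / a)) := by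
  have h2 : 0 ≤ derivWithin f (Ici 1) (1 / b) := hm.derivWithin_nonneg
  -- For `a = 0` the convention `1 / 0 = 0` leaves the domain of `f`; the claim then reduces to `f'
  -- ≥ 0`.
  rcases ha.eq_or_lt with rfl | ha
  · simp only [zero_sub, zero_mul]
    rw [mul_neg, div_mul_cancel₀ _ hb.ne']
    linarith
  have h1 := le_add_derivWithin_mul_sub_of_concaveOn hf hd (y := 1 / a) (z := 1 / b)
    ((one_le_div ha).2 ha1) ((one_le_div hb).2 hb1)
  calc derivWithin f (Ici 1) (1 / b) / b * (a - b)
      = a * (-(derivWithin f (Ici 1) (1 / b) * (1 / a - 1 / b))) := by field_simp; ring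
    _ ≤ _ := mul_le_mul_of_nonneg_left (by linarith) ha.le

/-- The excess loss at a point with `q < p` beats its linearization by a quadratic term. -/
lemma linear_add_sq_le_mul_sub (hs : LeftStronglyConcave f fun x => C x / x ^ 2)
    (hd : DifferentiableOn ℝ f (Ici 1)) {a b : ℝ} (ha1 : a ≤ 1) (hb : 0 < b) (hba : b < a) :
    derivWithin f (Ici 1) (1 / b) / b * (a - b) + C (1 / b) / 2 * ((a - b) ^ 2 / a)
      ≤ a * (f (1 / b) - f (1 / a)) := by
  have ha := hb.trans hba
  have h1 := hs.le_at_right hd (y := 1 / a) (z := 1 / b)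
    ((one_le_div ha).2 ha1) (one_div_le_one_div_of_le hb hba.le)
    ((one_lt_div hb).2 (hba.trans_le ha1))
  calc derivWithin f (Ici 1) (1 / b) / b * (a - b) + C (1 / b) / 2 * ((a - b) ^ 2 / a)
      = a * (-(derivWithin f (Ici 1) (1 / b) * (1 / a - 1 / b)
          - C (1 / b) / (1 / b) ^ 2 / 2 * (1 / a - 1 / b) ^ 2)) := by field_simp; ring
    _ ≤ _ := mul_le_mul_of_nonneg_left (by linarith) ha.le

/-- Jensen's inequality for the entropy-like sum `∑ pₓ f(1 / pₓ)` with an extra atom at `y`. -/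
lemma sum_mul_inv_add_le {X : Type*} (hf : ConcaveOn ℝ (Ici 1) f) (hm : MonotoneOn f (Ici 1))
    {p : X → ℝ} (A : Finset X) (hp0 : ∀ x ∈ A, 0 ≤ p x) (hp1 : ∀ x ∈ A, p x ≤ 1)
    {v y n : ℝ} (hv : 0 < v) (huv : ∑ x ∈ A, p x ≤ v) (hy : 1 ≤ y)
    (hn : A.card + (v - ∑ x ∈ A, p x) * y ≤ n) :
    ∑ x ∈ A, p x * f (1 / p x) + (v - ∑ x ∈ A, p x) * f y ≤ v * f (n / v) := by
  classical
  set u := ∑ x ∈ A, p x with hu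
  -- Null atoms are dropped, since `1 / 0 = 0` is not a legitimate argument of `f`.
  let B := A.filter fun x => 0 < p x
  have hzero : ∀ x ∈ A, x ∉ B → p x = 0 := fun x hx hxB =>
    le_antisymm (not_lt.1 fun h => hxB (Finset.mem_filter.2 ⟨hx, h⟩)) (hp0 x hx)
  have huB : ∑ x ∈ B, p x = u :=
    Finset.sum_subset (Finset.filter_subset _ _) hzero
  have hfB : ∑ x ∈ B, p x * f (1 / p x) = ∑ x ∈ A, p x * f (1 / p x) :=
    Finset.sum_subset (Finset.filter_subset _ _) fun x hx hxB => by simp [hzero x hx hxB]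
  have hcB : ∑ x ∈ B, p x * (1 / p x) = B.card := by
    rw [Finset.sum_congr rfl fun x hx => mul_one_div_cancel (Finset.mem_filter.1 hx).2.ne']
    simp
  have hcard : (B.card : ℝ) ≤ A.card := by exact_mod_cast Finset.card_filter_le _ _
  let w : Option X → ℝ := fun o => o.elim ((v - u) / v) fun x => p x / v
  let g : Option X → ℝ := fun o => o.elim y fun x => 1 / p x
  -- `none` is the extra atom at `y`. Each genuine atom contributes `p x / v * (1 / p x) = 1 / v` to
  -- the mean, which is therefore at most `n / v`.
  have key := hf.le_map_sum (t := Finset.insertNone B) (w := w) (p := g) (by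
      rintro (_ | x) hx
      · exact div_nonneg (by linarith) hv.le
      · exact div_nonneg (Finset.mem_filter.1 (Finset.some_mem_insertNone.1 hx)).2.le hv.le) (by
      rw [Finset.sum_insertNone]
      simp only [w, Option.elim]
      rw [← Finset.sum_div, huB, ← add_div, sub_add_cancel, div_self hv.ne']) (by
      rintro (_ | x) hx
      · exact hy
      · have := Finset.mem_filter.1 (Finset.some_mem_insertNone.1 hx)
        exact (one_le_div this.2).2 (hp1 x this.1))
  rw [Finset.sum_insertNone, Finset.sum_insertNone] at key
  simp only [w, g, Option.elim, smul_eq_mul] at key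
  have e1 : ∑ x ∈ B, p x / v * f (1 / p x) = (∑ x ∈ A, p x * f (1 / p x)) / v := by
    rw [← hfB, Finset.sum_div]
    exact Finset.sum_congr rfl fun x _ => by ring
  have e2 : ∑ x ∈ B, p x / v * (1 / p x) = B.card / v := by
    rw [← hcB, Finset.sum_div]
    exact Finset.sum_congr rfl fun x _ => by ring
  rw [e1, e2] at key
  have hmean : (v - u) / v * y + B.card / v ≤ n / v := by
    rw [div_mul_eq_mul_div, ← add_div]
    gcongr
    linarith
  have hmean1 : 1 ≤ (v - u) / v * y + B.card / v := by
    rw [div_mul_eq_mul_div, ← add_div, one_le_div hv]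
    have : u ≤ B.card := by
      rw [← huB]
      simpa using Finset.sum_le_card_nsmul B p 1 fun x hx => hp1 x (Finset.mem_filter.1 hx).1
    nlinarith
  have hle := key.trans (hm hmean1 (hmean1.trans hmean) hmean)
  calc _ = v * ((v - u) / v * f y + (∑ x ∈ A, p x * f (1 / p x)) / v) := by field_simp; ring
    _ ≤ _ := mul_le_mul_of_nonneg_left hle hv.le

end Concave

/-! ### Empirical losses and expectations over independent samples -/

lemma expectedLoss_empirical {X : Type u} [Fintype X] {m : ℕ} (ℓ : (X → ℝ) → X → ℝ) (q : X → ℝ) (s : Fin m → X) :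
    expectedLoss ℓ q (empirical s) = (∑ i, ℓ q (s i)) / m := by
  classical
  unfold expectedLoss empirical
  simp only [div_mul_eq_mul_div]
  rw [← Finset.sum_div, ← Finset.sum_fiberwise Finset.univ s fun i => ℓ q (s i)]
  congr 1
  refine Finset.sum_congr rfl fun x _ => ?_
  rw [Finset.sum_congr rfl (g := fun _ => ℓ q x) fun i hi => by rw [(Finset.mem_filter.1 hi).2]]
  simp only [Finset.sum_const, nsmul_eq_mul]

section Sampling

variable {X : Type u} [Fintype X] [MeasurableSpace X] [MeasurableSingletonClass X]
  {Ω : Type v} [MeasurableSpace Ω] {P : Measure Ω} [IsProbabilityMeasure P]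
  {m : ℕ} {S : Fin m → Ω → X} {p : X → ℝ}

lemma IsIIDSample.integral_comp (hS : IsIIDSample P S p) (φ : X → ℝ) (i : Fin m) :
    ∫ ω, φ (S i ω) ∂P = ∑ x, p x * φ x := by
  have := Measure.isProbabilityMeasure_map (μ := P) (hS.1 i).aemeasurable
  rw [← integral_map (f := φ) (hS.1 i).aemeasurable (measurable_of_finite φ).aestronglyMeasurable,
    integral_fintype .of_finite]
  refine Finset.sum_congr rfl fun x _ => ?_
  rw [map_measureReal_apply (hS.1 i) (measurableSet_singleton x), hS.2.2, smul_eq_mul]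

lemma IsIIDSample.integral_prod_comp (hS : IsIIDSample P S p) (φ : X → ℝ) :
    ∫ ω, ∏ i, φ (S i ω) ∂P = (∑ x, p x * φ x) ^ m := by
  rw [hS.2.1.integral_fun_prod_comp (f := fun _ => φ) (fun i => (hS.1 i).aemeasurable)
    fun i => (measurable_of_finite φ).aestronglyMeasurable]
  simp [hS.integral_comp]

end Sampling

/-! ### Chernoff bound restricted to a likely set -/

section Concentration

lemma IsIIDSample.measurableSet_preimage {X : Type u} [Fintype X] [MeasurableSpace X]
    [MeasurableSingletonClass X] {Ω : Type v} [MeasurableSpace Ω] {P : Measure Ω}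
    {m : ℕ} {S : Fin m → Ω → X} {p : X → ℝ} (hS : IsIIDSample P S p)
    (A : Set (Fin m → X)) :
    MeasurableSet {ω | (fun i => S i ω) ∈ A} :=
  (measurable_pi_lambda _ hS.1) (Set.toFinite A).measurableSet

variable {X : Type u} [Fintype X] [MeasurableSpace X] [MeasurableSingletonClass X]
  {Ω : Type v} [MeasurableSpace Ω] {P : Measure Ω} [IsProbabilityMeasure P]
  {m : ℕ} {S : Fin m → Ω → X} {p : X → ℝ}

lemma IsIIDSample.integrable_comp (hS : IsIIDSample P S p) (φ : (Fin m → X) → ℝ) :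
    Integrable (fun ω => φ fun i => S i ω) P := by
  have hm : Measurable fun ω i => S i ω := measurable_pi_lambda _ hS.1
  have := Measure.isProbabilityMeasure_map (μ := P) hm.aemeasurable
  exact (Integrable.of_finite (μ := P.map fun ω i => S i ω) (f := φ)).comp_measurable hm

lemma IsIIDSample.measureReal_le_integral (hS : IsIIDSample P S p) {A : Set (Fin m → X)}
    {φ : (Fin m → X) → ℝ} (h0 : ∀ s, 0 ≤ φ s) (h1 : ∀ s ∈ A, 1 ≤ φ s) :
    P.real {ω | (fun i => S i ω) ∈ A} ≤ ∫ ω, φ (fun i => S i ω) ∂P := by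
  rw [← integral_indicator_one (hS.measurableSet_preimage A)]
  refine integral_mono ((integrable_const 1).indicator (hS.measurableSet_preimage A))
    (hS.integrable_comp φ) fun ω => ?_
  by_cases h : (fun i => S i ω) ∈ A
  · simpa [Set.indicator, h] using h1 _ h
  · simpa [Set.indicator, h] using h0 _

/-- The probability that all samples lie in `G`. -/
lemma IsIIDSample.measureReal_forall_mem (hS : IsIIDSample P S p) (G : Finset X) :
    P.real {ω | ∀ i, S i ω ∈ G} = (∑ x ∈ G, p x) ^ m := by
  classical
  have h := hS.integral_prod_comp fun x => if x ∈ G then 1 else 0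
  simp only [mul_ite, mul_one, mul_zero, Finset.sum_ite_mem, Finset.univ_inter] at h
  have hms : MeasurableSet {ω | ∀ i, S i ω ∈ G} :=
    hS.measurableSet_preimage {s | ∀ i, s i ∈ G}
  rw [← h, ← integral_indicator_one hms]
  congr 1 with ω
  by_cases h : ∀ i, S i ω ∈ G
  · simp [h]
  · have h' : ω ∉ {ω | ∀ i, S i ω ∈ G} := h
    rw [Set.indicator_of_notMem h']
    obtain ⟨i, hi⟩ := not_forall.1 h
    exact (Finset.prod_eq_zero (Finset.mem_univ i) (if_neg hi)).symm

/-- A one-sided Chernoff bound for sample sums, on the event that all samples lie in `G`. -/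
lemma IsIIDSample.measureReal_sum_le (hS : IsIIDSample P S p) (G : Finset X)
    (hp : ∀ x, 0 ≤ p x) {Y : X → ℝ} {F t γ : ℝ} (hF : 0 < F) (hY : ∀ x ∈ G, |Y x| ≤ F)
    (hγ : 0 < γ) (hγF : γ ≤ 2 * F) (hM : (∑ x ∈ G, p x) * (t + γ) ≤ ∑ x ∈ G, p x * Y x) :
    P.real {ω | (∀ i, S i ω ∈ G) ∧ ∑ i, Y (S i ω) ≤ m * t}
      ≤ (∑ x ∈ G, p x) ^ m * Real.exp (-(m * (γ ^ 2 / (4 * F ^ 2)))) := by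
  classical
  set g := ∑ x ∈ G, p x with hg
  have hg0 : 0 ≤ g := Finset.sum_nonneg fun x _ => hp x
  -- This minimizes the exponent `-sγ + s²F²`, giving `-γ² / (4F²)`; `γ ≤ 2F` ensures `sF ≤ 1`, as
  -- the quadratic bound on `exp` requires.
  set s := γ / (2 * F ^ 2) with hs
  have hs0 : 0 < s := by positivity
  have hsF : s * F ≤ 1 := by
    rw [hs, div_mul_eq_mul_div, div_le_one (by positivity)]
    nlinarith
  let φ : X → ℝ := fun x => if x ∈ G then Real.exp (s * (t - Y x)) else 0
  have hφ0 : ∀ x, 0 ≤ φ x := fun x => by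
    by_cases h : x ∈ G <;> simp [φ, h, Real.exp_nonneg]
  have hsum : ∑ x, p x * φ x ≤ g * Real.exp (-(γ ^ 2 / (4 * F ^ 2))) := by
    have e1 : ∑ x, p x * φ x = Real.exp (s * t) * ∑ x ∈ G, p x * Real.exp (-(s * Y x)) := by
      simp only [φ, mul_ite, mul_zero, Finset.sum_ite_mem, Finset.univ_inter, Finset.mul_sum]
      refine Finset.sum_congr rfl fun x _ => ?_
      rw [mul_sub, sub_eq_add_neg, Real.exp_add]
      ring
    have e2 : ∑ x ∈ G, p x * Real.exp (-(s * Y x)) ≤ g - s * (∑ x ∈ G, p x * Y x)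
        + (s * F) ^ 2 * g := by
      rw [hg, Finset.mul_sum, Finset.mul_sum, ← Finset.sum_sub_distrib, ← Finset.sum_add_distrib]
      refine Finset.sum_le_sum fun x hx => ?_
      have h1 : |-(s * Y x)| ≤ s * F := by
        rw [abs_neg, abs_mul, abs_of_pos hs0]
        exact mul_le_mul_of_nonneg_left (hY x hx) hs0.le
      have h2 := (abs_le.1 (Real.abs_exp_sub_one_sub_id_le (h1.trans hsF))).2
      have h3 : (-(s * Y x)) ^ 2 ≤ (s * F) ^ 2 := sq_le_sq' (by linarith [(abs_le.1 h1).1])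
        (abs_le.1 h1).2
      nlinarith [hp x]
    have e3 : g - s * (∑ x ∈ G, p x * Y x) + (s * F) ^ 2 * g
        ≤ g * Real.exp (-(s * (t + γ)) + (s * F) ^ 2) := by
      have h1 := Real.add_one_le_exp (-(s * (t + γ)) + (s * F) ^ 2)
      nlinarith [mul_le_mul_of_nonneg_left hM hs0.le, mul_le_mul_of_nonneg_left h1 hg0]
    calc _ ≤ Real.exp (s * t) * (g * Real.exp (-(s * (t + γ)) + (s * F) ^ 2)) := by
            rw [e1]
            exact mul_le_mul_of_nonneg_left (e2.trans e3) (Real.exp_nonneg _)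
      _ = g * Real.exp (s * t + (-(s * (t + γ)) + (s * F) ^ 2)) := by
            rw [Real.exp_add (s * t)]; ring
      _ = _ := by
            congr 2
            rw [hs]
            field_simp
            ring
  calc _ ≤ ∫ ω, ∏ i, φ (S i ω) ∂P := by
        refine hS.measureReal_le_integral (A := {a | (∀ i, a i ∈ G) ∧ ∑ i, Y (a i) ≤ m * t})
          (φ := fun a => ∏ i, φ (a i)) (fun a => Finset.prod_nonneg fun i _ => hφ0 _) ?_
        rintro a ⟨ha, hat⟩
        simp only [φ, ha, if_true]
        rw [← Real.exp_sum]
        refine Real.one_le_exp ?_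
        rw [← Finset.mul_sum, Finset.sum_sub_distrib]
        simp only [Finset.sum_const, Finset.card_univ, Fintype.card_fin, nsmul_eq_mul]
        exact mul_nonneg hs0.le (by linarith)
    _ = (∑ x, p x * φ x) ^ m := hS.integral_prod_comp φ
    _ ≤ (g * Real.exp (-(γ ^ 2 / (4 * F ^ 2)))) ^ m :=
        pow_le_pow_left₀ (Finset.sum_nonneg fun x _ => mul_nonneg (hp x) (hφ0 x)) hsum m
    _ = _ := by rw [mul_pow, ← Real.exp_nat_mul, mul_neg]

/-- The sample mean of `Y` exceeds `t` with probability `1 - δ`, if its conditional mean on the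
likely set `G`, where it is bounded, exceeds `t` sufficiently. -/
lemma IsIIDSample.one_sub_le_measureReal_lt (hS : IsIIDSample P S p) (G : Finset X)
    (hp : ∀ x, 0 ≤ p x) {Y : X → ℝ} {F t γ δ : ℝ} (hF : 0 < F) (hY : ∀ x ∈ G, |Y x| ≤ F)
    (hγ : 0 < γ) (hγF : γ ≤ 2 * F) (hM : (∑ x ∈ G, p x) * (t + γ) ≤ ∑ x ∈ G, p x * Y x)
    (hm : 0 < m) (hδ : 0 < δ) (hδ1 : δ ≤ 1) (hG : m * (1 - ∑ x ∈ G, p x) ≤ δ / 4)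
    (hmδ : 8 * F ^ 2 * Real.log (1 / δ) / γ ^ 2 ≤ m) :
    1 - δ ≤ P.real {ω | t < (∑ i, Y (S i ω)) / m} := by
  have h1 := hS.measureReal_sum_le G hp hF hY hγ hγF hM
  set g := ∑ x ∈ G, p x with hg
  have hg0 : 0 ≤ g := Finset.sum_nonneg fun x _ => hp x
  have hexp : Real.exp (-(m * (γ ^ 2 / (4 * F ^ 2)))) ≤ δ ^ 2 := by
    rw [← Real.exp_log hδ, ← Real.exp_nat_mul]
    refine Real.exp_le_exp.2 ?_
    rw [div_le_iff₀ (by positivity), one_div, Real.log_inv] at hmδ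
    rw [neg_le, ← mul_div_assoc, le_div_iff₀ (by positivity)]
    push_cast
    nlinarith
  -- Bernoulli's inequality. As the failure bound also carries the factor `g ^ m`, the success
  -- probability is at least `(1 - δ/4)(1 - δ²)`, and this exceeds `1 - δ` by `δ(1 - δ)(3 - δ)/4`.
  have hgm : 1 - δ / 4 ≤ g ^ m := by
    have := one_add_mul_sub_le_pow (a := g) (by linarith) m
    linarith
  have hsub : {ω | ∀ i, S i ω ∈ G} ⊆ {ω | t < (∑ i, Y (S i ω)) / m} ∪
      {ω | (∀ i, S i ω ∈ G) ∧ ∑ i, Y (S i ω) ≤ m * t} := by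
    intro ω hω
    by_cases h : t < (∑ i, Y (S i ω)) / m
    · exact Or.inl h
    · right
      rw [not_lt, div_le_iff₀ (by exact_mod_cast hm)] at h
      exact ⟨hω, by linarith⟩
  have h2 := (measureReal_mono (μ := P) hsub).trans (measureReal_union_le _ _)
  rw [hS.measureReal_forall_mem G] at h2
  have h3 : g ^ m * Real.exp (-(m * (γ ^ 2 / (4 * F ^ 2)))) ≤ g ^ m * δ ^ 2 :=
    mul_le_mul_of_nonneg_left hexp (pow_nonneg hg0 m)
  have h4 : (1 - δ / 4) * (1 - δ ^ 2) ≤ g ^ m * (1 - δ ^ 2) :=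
    mul_le_mul_of_nonneg_right hgm (by nlinarith)
  nlinarith [mul_nonneg hδ.le (sub_nonneg.2 hδ1), sq_nonneg δ]

end Concentration

/-! ### Calibration as inequalities between sums over levels -/

section Calibration

lemma mem_bucket {X : Type u} {q : X → ℝ} {t : ℝ} {x : X} : x ∈ bucket q t ↔ q x = t := Iff.rfl

open Classical in
lemma mass_eq_sum_filter {X : Type u} [Fintype X] (r : X → ℝ) (B : Set X) :
    mass r B = ∑ x with x ∈ B, r x := by
  rw [mass, Finset.sum_filter]

/-- A weight depending only on `q x` is constant on buckets, which lets bucketwise calibration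
control weighted sums. -/
lemma sum_filter_mem_eq_sum_mass {X : Type u} [Fintype X] (q : X → ℝ) (R : Set ℝ)
    [DecidablePred (· ∈ R)] (w : ℝ → ℝ) (r : X → ℝ) :
    ∑ x with q x ∈ R, w (q x) * r x
      = ∑ t ∈ Finset.univ.image q with t ∈ R, w t * mass r (bucket q t) := by
  classical
  rw [← Finset.sum_fiberwise_of_maps_to (g := q)
    (t := (Finset.univ.image q).filter (· ∈ R)) (fun x hx => by
      simpa using (Finset.mem_filter.1 hx).2)]
  refine Finset.sum_congr rfl fun t ht => ?_
  have htR := (Finset.mem_filter.1 ht).2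
  rw [mass_eq_sum_filter, Finset.mul_sum, Finset.filter_filter]
  refine Finset.sum_congr ?_ fun x hx => ?_
  · ext x
    simp only [Finset.mem_filter, Finset.mem_univ, true_and, mem_bucket]
    exact ⟨fun h => h.2, fun h => ⟨h ▸ htR, h⟩⟩
  · rw [show q x = t from (Finset.mem_filter.1 hx).2]

lemma mass_nonneg {X : Type u} [Fintype X] {r : X → ℝ} (hr : ∀ x, 0 ≤ r x) (B : Set X) :
    0 ≤ mass r B := by
  classical
  rw [mass_eq_sum_filter]
  exact Finset.sum_nonneg fun x _ => hr x

lemma stdSimplex_le_one {X : Type u} [Fintype X] {p : X → ℝ} (hp : p ∈ stdSimplex ℝ X) (x : X) :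
    p x ≤ 1 :=
  hp.2 ▸ Finset.single_le_sum (fun y _ => hp.1 y) (Finset.mem_univ x)

lemma sum_le_one_of_stdSimplex {X : Type u} [Fintype X] {p : X → ℝ} (hp : p ∈ stdSimplex ℝ X)
    (A : Finset X) : ∑ x ∈ A, p x ≤ 1 :=
  hp.2 ▸ Finset.sum_le_univ_sum_of_nonneg hp.1

lemma sum_max_sub_zero {X : Type u} [Fintype X] {p q : X → ℝ} (hp : p ∈ stdSimplex ℝ X)
    (hq : q ∈ stdSimplex ℝ X) : ∑ x, max (p x - q x) 0 = l1Dist p q / 2 := by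
  have h : ∀ x, max (p x - q x) 0 = |p x - q x| / 2 + (p x / 2 - q x / 2) := fun x => by
    rcases le_total 0 (p x - q x) with h | h
    · rw [max_eq_left h, abs_of_nonneg h]; ring
    · rw [max_eq_right h, abs_of_nonpos h]; ring
  simp only [h, Finset.sum_add_distrib, Finset.sum_sub_distrib, ← Finset.sum_div, hp.2, hq.2,
    sub_self, add_zero, l1Dist]

lemma l1Dist_le_two {X : Type u} [Fintype X] {p q : X → ℝ} (hp : p ∈ stdSimplex ℝ X)
    (hq : q ∈ stdSimplex ℝ X) : l1Dist p q ≤ 2 := by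
  calc l1Dist p q ≤ ∑ x, (p x + q x) := Finset.sum_le_sum fun x _ =>
        abs_sub_le_iff.2 ⟨by linarith [hq.1 x], by linarith [hp.1 x, hq.1 x]⟩
    _ = 2 := by rw [Finset.sum_add_distrib, hp.2, hq.2]; norm_num

lemma l1Dist_nonneg {X : Type u} [Fintype X] (p q : X → ℝ) : 0 ≤ l1Dist p q :=
  Finset.sum_nonneg fun _ _ => abs_nonneg _

variable {X : Type u} [Fintype X] {p q : X → ℝ} {α₁ α₂ : ℝ}

lemma ApproxCalibrated.le_mass_bucket (h : ApproxCalibrated p α₁ α₂ q) {t : ℝ}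
    (ht : t ∈ Icc (0 : ℝ) 1) :
    (1 - α₁) * mass p (bucket q t) ≤ mass q (bucket q t) := by
  obtain ⟨T, _, h1, h2, _⟩ := h
  by_cases htT : t ∈ T
  · exact h2 t htT
  · exact (h1 t ⟨ht, htT⟩).1

lemma ApproxCalibrated.le_sum_filter (h : ApproxCalibrated p α₁ α₂ q)
    (hq : q ∈ stdSimplex ℝ X) (R : Set ℝ)
    [DecidablePred (· ∈ R)] :
    (1 - α₁) * ∑ x with q x ∈ R, p x ≤ ∑ x with q x ∈ R, q x := by
  have e := fun r => sum_filter_mem_eq_sum_mass q R (fun _ => 1) r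
  simp only [one_mul] at e
  rw [e, e, Finset.mul_sum]
  refine Finset.sum_le_sum fun t ht => h.le_mass_bucket ?_
  obtain ⟨x, -, rfl⟩ := Finset.mem_image.1 (Finset.mem_filter.1 ht).1
  exact ⟨hq.1 x, stdSimplex_le_one hq x⟩

/-- Each `qₓ` is at least a fraction `(1 - α₁) / N` of `pₓ`. -/
lemma ApproxCalibrated.mul_le_card_mul (h : ApproxCalibrated p α₁ α₂ q)
    (hp : p ∈ stdSimplex ℝ X) (hq : q ∈ stdSimplex ℝ X) (hα : α₁ ≤ 1) (x : X) :
    (1 - α₁) * p x ≤ Fintype.card X * q x := by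
  classical
  have h1 := h.le_sum_filter hq {q x}
  have h2 : p x ≤ ∑ y with q y ∈ ({q x} : Set ℝ), p y :=
    Finset.single_le_sum (fun y _ => hp.1 y) (by simp)
  have h3 : ∑ y with q y ∈ ({q x} : Set ℝ), q y ≤ Fintype.card X * q x := by
    calc _ ≤ ((Finset.univ.filter fun y => q y ∈ ({q x} : Set ℝ)).card : ℝ) * q x := by
          rw [← nsmul_eq_mul]
          exact Finset.sum_le_card_nsmul _ _ _ fun y hy => le_of_eq (by simpa using hy)
      _ ≤ _ := mul_le_mul_of_nonneg_right
          (by exact_mod_cast Finset.card_le_univ _) (hq.1 x)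
  nlinarith

open Classical in
/-- The defining data of calibration in terms of sums: a set of exceptional levels of small mass,
outside of which weighted sums over buckets are close. -/
lemma ApproxCalibrated.exists_levels (h : ApproxCalibrated p α₁ α₂ q)
    (hp : p ∈ stdSimplex ℝ X) (hq : q ∈ stdSimplex ℝ X) (hα₂ : α₂ < 1) :
    0 ≤ α₁ ∧ ∃ T : Set ℝ, ∑ x with q x ∈ T, q x ≤ α₂ ∧
      ∀ (R : Set ℝ) [DecidablePred (· ∈ R)] (w : ℝ → ℝ) (M : ℝ), (∀ x, q x ∈ R → q x ∉ T ∧ 0 ≤ w (q x) ∧ w (q x) ≤ M) →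
        0 ≤ M → -(α₁ * M) ≤ ∑ x with q x ∈ R, w (q x) * (p x - q x) := by
  obtain ⟨T, _, h1, _, h3⟩ := h
  have hT : ∑ x with q x ∈ T, q x ≤ α₂ := by
    convert h3
    rw [mass_eq_sum_filter]
    refine Finset.sum_congr (Finset.filter_congr fun x _ => ?_) fun _ _ => rfl
    simp [bucket]
  have hIcc : ∀ x, q x ∈ Icc (0 : ℝ) 1 := fun x => ⟨hq.1 x, stdSimplex_le_one hq x⟩
  -- If `α₁ < 0`, the two-sided bound forces every unexceptional bucket to have zero `p`-mass, hence
  -- zero `q`-mass; then `T` carries all of `q`, against `α₂ < 1`.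
  have hα₁ : 0 ≤ α₁ := by
    by_contra hneg
    push Not at hneg
    have e := sum_filter_mem_eq_sum_mass q Tᶜ (fun _ => 1) q
    simp only [one_mul] at e
    have h0 : ∑ x with q x ∈ Tᶜ, q x ≤ 0 := by
      rw [e]
      refine Finset.sum_nonpos fun t ht => ?_
      obtain ⟨ht1, ht2⟩ := Finset.mem_filter.1 ht
      obtain ⟨x, -, rfl⟩ := Finset.mem_image.1 ht1
      have h5 := h1 _ ⟨hIcc x, ht2⟩
      have h6 := mass_nonneg hp.1 (bucket q (q x))
      have h7 : mass p (bucket q (q x)) ≤ 0 := by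
        by_contra hlt
        nlinarith [h5.1, h5.2, mul_neg_of_neg_of_pos hneg (not_le.1 hlt)]
      rw [le_antisymm h7 h6] at h5
      simpa using h5.2
    have h7 := Finset.sum_filter_add_sum_filter_not Finset.univ (fun x => q x ∈ T) q
    rw [hq.2] at h7
    simp only [mem_compl_iff] at h0
    linarith
  refine ⟨hα₁, T, hT, fun R _ w M hR hM => ?_⟩
  have e := fun r => sum_filter_mem_eq_sum_mass q R w r
  have hp1 := sum_filter_mem_eq_sum_mass q R (fun _ => 1) p
  simp only [one_mul] at hp1
  simp only [mul_sub, Finset.sum_sub_distrib]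
  rw [e, e, ← Finset.sum_sub_distrib]
  calc -(α₁ * M) ≤ -(α₁ * M) * ∑ x with q x ∈ R, p x := by
        nlinarith [sum_le_one_of_stdSimplex hp (Finset.univ.filter fun x => q x ∈ R),
          mul_nonneg hα₁ hM]
    _ ≤ _ := by
        rw [hp1, Finset.mul_sum]
        refine Finset.sum_le_sum fun t ht => ?_
        obtain ⟨ht1, ht2⟩ := Finset.mem_filter.1 ht
        obtain ⟨x, -, rfl⟩ := Finset.mem_image.1 ht1
        obtain ⟨hxT, hw0, hwM⟩ := hR x ht2
        have h5 := (h1 _ ⟨hIcc x, hxT⟩).2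
        have h6 := mul_nonneg hα₁ (mass_nonneg hp.1 (bucket q (q x)))
        nlinarith [mul_le_mul_of_nonneg_left h5 hw0, mul_le_mul_of_nonneg_right hwM h6]

end Calibration

/-! ### Quadratic gain on well-calibrated levels -/

section ExcessLoss

variable {X : Type u} [Fintype X] {p q : X → ℝ} {f C : ℝ → ℝ}

/-- On levels where calibration holds, the excess loss has a quadratic gain. -/
lemma sq_sum_le_sum_mul_sub (hf : ConcaveOn ℝ (Ici 1) f) (hd : DifferentiableOn ℝ f (Ici 1))
    (hm : MonotoneOn f (Ici 1)) (hs : LeftStronglyConcave f fun x => C x / x ^ 2)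
    (hC : AntitoneOn C (Ici 1)) (hC0 : ∀ x, 1 ≤ x → 0 ≤ C x)
    (hp : p ∈ stdSimplex ℝ X) (hq : q ∈ stdSimplex ℝ X) (G : Finset X) {E : ℝ} (hE : 1 ≤ E)
    (hG : ∀ x ∈ G, 0 < q x ∧ 1 / q x ≤ E) :
    C E / 2 * (∑ x ∈ G, max (p x - q x) 0) ^ 2
        + ∑ x ∈ G, derivWithin f (Ici 1) (1 / q x) / q x * (p x - q x)
      ≤ ∑ x ∈ G, p x * (f (1 / q x) - f (1 / p x)) := by
  have hcs : (∑ x ∈ G, max (p x - q x) 0) ^ 2 ≤ ∑ x ∈ G, max (p x - q x) 0 ^ 2 / p x := by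
    have h1 := Finset.sum_sq_le_sum_mul_sum_of_sq_le_mul G (r := fun x => max (p x - q x) 0)
      (f := fun x => max (p x - q x) 0 ^ 2 / p x) (g := p)
      (fun x _ => div_nonneg (sq_nonneg _) (hp.1 x)) (fun x _ => hp.1 x) fun x _ => by
        rcases (hp.1 x).eq_or_lt with h | h
        · rw [← h, max_eq_right (by linarith [hq.1 x])]; simp
        · exact (div_mul_cancel₀ _ h.ne').ge
    refine h1.trans (mul_le_of_le_one_right ?_ (sum_le_one_of_stdSimplex hp G))
    exact Finset.sum_nonneg fun x _ => div_nonneg (sq_nonneg _) (hp.1 x)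
  have hpt : ∀ x ∈ G, C E / 2 * (max (p x - q x) 0 ^ 2 / p x)
      + derivWithin f (Ici 1) (1 / q x) / q x * (p x - q x)
        ≤ p x * (f (1 / q x) - f (1 / p x)) := by
    intro x hx
    obtain ⟨h0, hxE⟩ := hG x hx
    have hq1 := stdSimplex_le_one hq x
    rcases le_or_gt (p x) (q x) with h | h
    · rw [max_eq_right (by linarith)]
      simpa using linear_le_mul_sub hf hd hm (hp.1 x) (stdSimplex_le_one hp x) h0 hq1
    · rw [max_eq_left (by linarith)]
      have h1 := linear_add_sq_le_mul_sub hs hd (stdSimplex_le_one hp x) h0 h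
      have h2 : C E ≤ C (1 / q x) := hC ((one_le_div h0).2 hq1) hE hxE
      have h3 : 0 ≤ (p x - q x) ^ 2 / p x := div_nonneg (sq_nonneg _) (hp.1 x)
      nlinarith
  calc _ ≤ C E / 2 * (∑ x ∈ G, max (p x - q x) 0 ^ 2 / p x)
        + ∑ x ∈ G, derivWithin f (Ici 1) (1 / q x) / q x * (p x - q x) := by
        gcongr
        exact div_nonneg (hC0 E hE) zero_le_two
    _ ≤ _ := by
        rw [Finset.mul_sum, ← Finset.sum_add_distrib]
        exact Finset.sum_le_sum hpt

end ExcessLoss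

/-! ### Lower bound on the expected excess loss -/

section ExcessLossBound

variable {X : Type u} [Fintype X] {p q : X → ℝ} {f C D : ℝ → ℝ} {α₁ α₂ N : ℝ}

lemma ApproxCalibrated.pos_of_pos (h : ApproxCalibrated p α₁ α₂ q) (hp : p ∈ stdSimplex ℝ X)
    (hq : q ∈ stdSimplex ℝ X) (hα : α₁ < 1) {x : X} (hx : 0 < p x) : 0 < q x := by
  have h1 := h.mul_le_card_mul hp hq hα.le x
  have h2 : 0 < Fintype.card X * q x := (mul_pos (sub_pos.2 hα) hx).trans_le h1
  exact pos_of_mul_pos_right h2 (Nat.cast_nonneg _)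

set_option maxHeartbeats 800000 in
/-- The expected excess loss of an approximately calibrated distribution is quadratic in its
`ℓ₁` distance, up to the calibration errors. -/
theorem ApproxCalibrated.le_sum_mul_sub (h : ApproxCalibrated p α₁ α₂ q)
    (hp : p ∈ stdSimplex ℝ X) (hq : q ∈ stdSimplex ℝ X)
    (hf0 : ∀ z, 1 ≤ z → 0 ≤ f z) (hm : MonotoneOn f (Ici 1)) (hf : ConcaveOn ℝ (Ici 1) f)
    (hd : DifferentiableOn ℝ f (Ici 1)) (hDm : MonotoneOn D (Ici 1))
    (hD : ∀ z, 1 ≤ z → derivWithin f (Ici 1) z ≤ D z / z)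
    (hs : LeftStronglyConcave f fun x => C x / x ^ 2)
    (hC : AntitoneOn C (Ici 1)) (hC0 : ∀ x, 1 ≤ x → 0 ≤ C x)
    (hα₂ : 0 < α₂) (hα₁l : α₁ ≤ l1Dist p q ^ 2 / 12) (hα₂l : α₂ ≤ l1Dist p q ^ 2 / 12)
    (hN : N = Fintype.card X) :
    C (N / (2 * α₂)) * (l1Dist p q ^ 2 / 200) - α₁ * D (N / (2 * α₂))
        - 3 * α₂ * f (N / (3 * α₂))
      ≤ ∑ x, p x * (f (1 / q x) - f (1 / p x)) := by
  classical
  have hsum := sum_max_sub_zero hp hq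
  have hΔ2 := l1Dist_le_two hp hq
  have hΔn := l1Dist_nonneg p q
  set Δ := l1Dist p q
  have hα₁3 : α₁ ≤ 1 / 3 := by nlinarith
  have hα₂3 : α₂ ≤ 1 / 3 := by nlinarith
  have hΔ : 0 < Δ := by
    rcases hΔn.eq_or_lt with h | h
    · rw [← h] at hα₂l; norm_num at hα₂l; linarith
    · exact h
  have hN1 : 1 ≤ N := by
    have hX : Nonempty X := by
      by_contra hX
      have := not_nonempty_iff.1 hX
      simpa using hp.2
    rw [hN]
    exact_mod_cast Fintype.card_pos
  have hN0 : 0 < N := by linarith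
  have hE1 : 1 ≤ N / (2 * α₂) := by
    rw [one_le_div (by positivity)]; linarith
  set E := N / (2 * α₂) with hE
  obtain ⟨hα₁, T, hT, hcal⟩ := h.exists_levels hp hq (by linarith)
  have hqpos : ∀ x, 0 < p x → 0 < q x := fun x => h.pos_of_pos hp hq (by linarith)
  let R : Set ℝ := T ∪ {t | t < 2 * α₂ / N}
  set S := Finset.univ.filter fun x => q x ∈ R with hSdef
  set G := Finset.univ.filter fun x => q x ∈ Rᶜ
  have hsplit : ∀ φ : X → ℝ, ∑ x ∈ S, φ x + ∑ x ∈ G, φ x = ∑ x, φ x := fun φ =>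
    Finset.sum_filter_add_sum_filter_not _ _ _
  have hG : ∀ x, q x ∈ Rᶜ → q x ∉ T ∧ 0 < q x ∧ 1 / q x ≤ E := by
    intro x hx
    have h1 : q x ∉ T ∧ 2 * α₂ / N ≤ q x := by simpa [R] using hx
    have h2 : 0 < q x := lt_of_lt_of_le (by positivity) h1.2
    refine ⟨h1.1, h2, ?_⟩
    rw [hE, div_le_div_iff₀ h2 (by positivity)]
    have := (div_le_iff₀ hN0).1 h1.2
    linarith
  -- Exceptional levels carry at most `α₂`, and at most `N` points below `2α₂ / N` carry less than
  -- `2α₂`. Strictness yields a point outside `S` even when `3α₂ = 1`.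
  have hqS : ∑ x ∈ S, q x < 3 * α₂ := by
    set B := Finset.univ.filter fun x => q x < 2 * α₂ / N with hB
    have hSB : S = (Finset.univ.filter fun x => q x ∈ T) ∪ B := by
      ext x; simp [hSdef, hB, R]
    have h1 : ∑ x ∈ B, q x < 2 * α₂ := by
      rcases B.eq_empty_or_nonempty with h0 | h0
      · rw [h0]; simpa using hα₂
      · calc ∑ x ∈ B, q x < ∑ x ∈ B, 2 * α₂ / N :=
              Finset.sum_lt_sum_of_nonempty h0 fun x hx => (Finset.mem_filter.1 hx).2
          _ = B.card * (2 * α₂ / N) := by rw [Finset.sum_const, nsmul_eq_mul]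
          _ ≤ N * (2 * α₂ / N) := by
              gcongr
              rw [hN]
              exact_mod_cast Finset.card_le_univ _
          _ = 2 * α₂ := by field_simp
    have h2 := Finset.sum_union_inter (s₁ := Finset.univ.filter fun x => q x ∈ T) (s₂ := B)
      (f := q)
    have h3 : 0 ≤ ∑ x ∈ (Finset.univ.filter fun x => q x ∈ T) ∩ B, q x :=
      Finset.sum_nonneg fun x _ => hq.1 x
    rw [hSB]
    linarith
  have hpS : ∑ x ∈ S, p x ≤ 9 / 2 * α₂ := by
    have h1 := h.le_sum_filter hq R
    have h2 : 0 ≤ ∑ x ∈ S, p x := Finset.sum_nonneg fun x _ => hp.1 x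
    nlinarith
  have hgood : C E / 2 * (∑ x ∈ G, max (p x - q x) 0) ^ 2 - α₁ * D E
      ≤ ∑ x ∈ G, p x * (f (1 / q x) - f (1 / p x)) := by
    have h1 := sq_sum_le_sum_mul_sub hf hd hm hs hC hC0 hp hq G hE1 fun x hx =>
      (hG x (Finset.mem_filter.1 hx).2).2
    have hd0 : ∀ z, 0 ≤ derivWithin f (Ici 1) z := fun z => hm.derivWithin_nonneg
    have hDE : 0 ≤ D E := by
      have := (hd0 E).trans (hD E hE1)
      rw [le_div_iff₀ (by linarith), zero_mul] at this
      exact this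
    have h2 := hcal Rᶜ (fun t => derivWithin f (Ici 1) (1 / t) / t) (D E) (fun x hx => by
      obtain ⟨hxT, hx0, hxE⟩ := hG x hx
      have hx1 : 1 ≤ 1 / q x := (one_le_div hx0).2 (stdSimplex_le_one hq x)
      refine ⟨hxT, div_nonneg (hd0 _) hx0.le, ?_⟩
      have h3 := hD _ hx1
      rw [div_div_eq_mul_div, div_one] at h3
      rw [div_le_iff₀ hx0]
      exact h3.trans (mul_le_mul_of_nonneg_right (hDm hx1 hE1 hxE) hx0.le)) hDE
    linarith
  set S' := S.filter fun x => p x < q x with hS'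
  have hbad : ∑ x ∈ S', p x * f (1 / q x) - ∑ x ∈ S', p x * f (1 / p x)
      ≤ ∑ x ∈ S, p x * (f (1 / q x) - f (1 / p x)) := by
    rw [← Finset.sum_sub_distrib]
    simp only [← mul_sub]
    refine Finset.sum_le_sum_of_subset_of_nonneg (Finset.filter_subset _ _) fun x hx hx' => ?_
    have hle : q x ≤ p x := not_lt.1 fun h => hx' (Finset.mem_filter.2 ⟨hx, h⟩)
    rcases (hp.1 x).eq_or_lt with hx0 | hx0
    · simp [← hx0]
    have hq0 := hqpos x hx0
    have h1 := one_div_le_one_div_of_le hq0 hle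
    have h2 := (one_le_div hx0).2 (stdSimplex_le_one hp x)
    exact mul_nonneg hx0.le (sub_nonneg.2 (hm h2 (h2.trans h1) h1))
  set u := ∑ x ∈ S', p x with hu
  have hu0 : 0 ≤ u := Finset.sum_nonneg fun x _ => hp.1 x
  have huv : u ≤ 3 * α₂ := by
    calc u ≤ ∑ x ∈ S', q x := Finset.sum_le_sum fun x hx => (Finset.mem_filter.1 hx).2.le
      _ ≤ ∑ x ∈ S, q x := Finset.sum_le_sum_of_subset_of_nonneg (Finset.filter_subset _ _)
          fun x _ _ => hq.1 x
      _ ≤ _ := hqS.le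
  have hjensen : ∀ y, 1 ≤ y → S'.card + (3 * α₂ - u) * y ≤ N →
      ∑ x ∈ S', p x * f (1 / p x) + (3 * α₂ - u) * f y ≤ 3 * α₂ * f (N / (3 * α₂)) :=
    fun y hy hn => sum_mul_inv_add_le hf hm S' (fun x _ => hp.1 x)
      (fun x _ => stdSimplex_le_one hp x) (by positivity) huv hy hn
  obtain ⟨x₀, hx₀⟩ : ∃ x, x ∉ S := by
    by_contra! hall
    have : S = Finset.univ := Finset.eq_univ_iff_forall.2 hall
    rw [this, hq.2] at hqS
    linarith
  have hx₀' : x₀ ∉ S' := fun hx => hx₀ (Finset.mem_filter.1 hx).1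
  have hmax := hsplit fun x => max (p x - q x) 0
  rw [hsum] at hmax
  rw [← hsplit]
  -- The positive part of `p - q` totals `Δ / 2`. If `G` holds at least `Δ / 10`, the quadratic gain
  -- is already `C(E) Δ² / 200`. Otherwise `S` holds at least `2Δ / 5`, so `α₂` is of order at least
  -- `Δ` and the gain comes from slack in Jensen.
  rcases le_or_gt (Δ / 10) (∑ x ∈ G, max (p x - q x) 0) with hcase | hcase
  · have hcard : (S'.card : ℝ) + 1 ≤ N := by
      rw [hN]
      have := Finset.card_le_univ (insert x₀ S')
      rw [Finset.card_insert_of_notMem hx₀'] at this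
      exact_mod_cast this
    have h1 := hjensen 1 le_rfl (by linarith)
    have h2 : 0 ≤ (3 * α₂ - u) * f 1 := mul_nonneg (by linarith) (hf0 1 le_rfl)
    have h3 : 0 ≤ ∑ x ∈ S', p x * f (1 / q x) := Finset.sum_nonneg fun x _ => by
      rcases (hp.1 x).eq_or_lt with hx | hx
      · simp [← hx]
      · exact mul_nonneg hx.le (hf0 _ ((one_le_div (hqpos x hx)).2 (stdSimplex_le_one hq x)))
    have h4 : (Δ / 10) ^ 2 ≤ (∑ x ∈ G, max (p x - q x) 0) ^ 2 := by gcongr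
    nlinarith [mul_le_mul_of_nonneg_left h4 (hC0 E hE1)]
  · obtain ⟨x₁, hx₁S, hx₁⟩ : ∃ x ∈ S, q x < p x := by
      by_contra! hall
      have : ∑ x ∈ S, max (p x - q x) 0 = 0 := Finset.sum_eq_zero fun x hx =>
        max_eq_right (by linarith [hall x hx])
      linarith
    have hx₁' : x₁ ∉ S' := fun hx => (Finset.mem_filter.1 hx).2.not_gt hx₁
    have hcard : (S'.card : ℝ) + 2 ≤ N := by
      rw [hN]
      have := Finset.card_le_univ (insert x₀ (insert x₁ S'))
      rw [Finset.card_insert_of_notMem, Finset.card_insert_of_notMem hx₁'] at this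
      · exact_mod_cast this
      · simp only [Finset.mem_insert, hx₀', or_false]
        rintro rfl
        exact hx₀ hx₁S
    have hN2 : 2 ≤ N := by linarith [Nat.cast_nonneg (α := ℝ) S'.card]
    -- The points `x₀` and `x₁` outside `S'` leave room for the extra atom at `2`, since `3α₂ ≤ 1`.
    -- With `q ≤ 1/2` on `S'`, this saves `3α₂ f(2)` in total.
    have h1 := hjensen 2 one_le_two (by linarith)
    have h2 : u * f 2 ≤ ∑ x ∈ S', p x * f (1 / q x) := by
      rw [hu, Finset.sum_mul]
      refine Finset.sum_le_sum fun x hx => ?_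
      rcases (hp.1 x).eq_or_lt with hx0 | hx0
      · simp [← hx0]
      have hq0 := hqpos x hx0
      have hq2 : q x ≤ 1 / 2 := by
        rcases (Finset.mem_filter.1 (Finset.mem_filter.1 hx).1).2 with hxT | hxN
        · have : q x ≤ ∑ x with q x ∈ T, q x :=
            Finset.single_le_sum (fun y _ => hq.1 y) (by simpa using hxT)
          linarith
        · have h3 : q x < 2 * α₂ / N := hxN
          rw [lt_div_iff₀ hN0] at h3
          nlinarith
      have h4 : 2 ≤ 1 / q x := by rw [le_div_iff₀ hq0]; linarith
      exact mul_le_mul_of_nonneg_left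
        (hm (mem_Ici.2 one_le_two) (mem_Ici.2 (one_le_two.trans h4)) h4) hx0.le
    have hpmax : ∑ x ∈ S, max (p x - q x) 0 ≤ ∑ x ∈ S, p x := Finset.sum_le_sum fun x _ =>
      max_le (by linarith [hq.1 x]) (hp.1 x)
    have h3 : Δ * (2 / 5) ≤ 9 / 2 * α₂ := by linarith
    have hE2 : 2 ≤ E := by
      rw [hE, le_div_iff₀ (by positivity)]; linarith
    have h4 : C E / 8 ≤ f 2 := by
      have := hs.div_eight_le hd hm (hf0 1 le_rfl)
      have := hC (mem_Ici.2 one_le_two) hE1 hE2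
      linarith
    have h5 : C E * (Δ ^ 2 / 200) ≤ 3 * α₂ * f 2 := by
      have h6 := hC0 E hE1
      calc C E * (Δ ^ 2 / 200) ≤ C E * (3 * α₂ / 8) :=
            mul_le_mul_of_nonneg_left (by nlinarith) h6
        _ = 3 * α₂ * (C E / 8) := by ring
        _ ≤ _ := mul_le_mul_of_nonneg_left h4 (by positivity)
    have h7 : 0 ≤ C E / 2 * (∑ x ∈ G, max (p x - q x) 0) ^ 2 :=
      mul_nonneg (by linarith [hC0 E hE1]) (sq_nonneg _)
    linarith

end ExcessLossBound

/-! ### Discarding points of tiny probability; the choice of `β` -/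

section Truncation

variable {X : Type u} [Fintype X] {p q : X → ℝ}

lemma two_le_card_of_l1Dist_pos (hp : p ∈ stdSimplex ℝ X) (hq : q ∈ stdSimplex ℝ X)
    (h : 0 < l1Dist p q) : 2 ≤ Fintype.card X := by
  by_contra hlt
  have hsub : Subsingleton X := Fintype.card_le_one_iff_subsingleton.1 (by omega)
  have h1 : ∀ r ∈ stdSimplex ℝ X, ∀ x, r x = 1 := fun r hr x => by
    rw [← hr.2, Fintype.sum_subsingleton _ x]
  simp [l1Dist, h1 p hp, h1 q hq] at h

/-- The contribution to the excess loss of the elements of small probability is small. -/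
lemma sum_mul_sub_le_of_lt {f : ℝ → ℝ} {c β N : ℝ} (hf0 : ∀ z, 1 ≤ z → 0 ≤ f z)
    (hfc : ∀ z, 1 ≤ z → f z ≤ c * √z) (hc : 0 ≤ c) (hβ : 0 < β) (hN : N = Fintype.card X)
    (hp : p ∈ stdSimplex ℝ X) (hq : q ∈ stdSimplex ℝ X)
    (hpq : ∀ x, 2 / 3 * p x ≤ N * q x) (B : Finset X) (hB : ∀ x ∈ B, p x < 2 * N / β) :
    ∑ x ∈ B, p x * (f (1 / q x) - f (1 / p x)) ≤ 2 * c * N ^ 2 / √β := by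
  have hN0 : 0 ≤ N := hN ▸ Nat.cast_nonneg _
  have hpt : ∀ x ∈ B, p x * (f (1 / q x) - f (1 / p x)) ≤ c * (2 * N / √β) := by
    intro x hx
    rcases (hp.1 x).eq_or_lt with h0 | h0
    · rw [← h0, zero_mul]; positivity
    have hq0 : 0 < q x := pos_of_mul_pos_right (lt_of_lt_of_le (by positivity) (hpq x)) hN0
    have h1 := hf0 _ ((one_le_div h0).2 (stdSimplex_le_one hp x))
    have h2 := hfc _ ((one_le_div hq0).2 (stdSimplex_le_one hq x))
    -- After squaring: `p² / q ≤ (3/2) N p < 3N² / β`.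
    have h3 : p x * √(1 / q x) ≤ 2 * N / √β := by
      rw [← sq_le_sq₀ (by positivity) (by positivity), mul_pow, div_pow,
        Real.sq_sqrt (by positivity), Real.sq_sqrt hβ.le, mul_one_div,
        div_le_div_iff₀ hq0 hβ]
      have h4 := (lt_div_iff₀ hβ).1 (hB x hx)
      nlinarith [mul_le_mul_of_nonneg_left h4.le h0.le,
        mul_le_mul_of_nonneg_left (hpq x) hN0]
    calc _ ≤ p x * (c * √(1 / q x)) := by gcongr; linarith
      _ = c * (p x * √(1 / q x)) := by ring
      _ ≤ _ := by gcongr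
  calc _ ≤ B.card * (c * (2 * N / √β)) := by
        rw [← nsmul_eq_mul]
        exact Finset.sum_le_card_nsmul _ _ _ hpt
    _ ≤ N * (c * (2 * N / √β)) := by
        refine mul_le_mul_of_nonneg_right ?_ (by positivity)
        rw [hN]
        exact_mod_cast Finset.card_le_univ _
    _ = _ := by ring

/-- The formula for `β` gives `√β ≥ 24 N⁴ / a`. For `a = C(2N/α₂) Δ² / (128c)` the resulting bound
equals `C(2N/α₂) Δ² / 1536`. -/
lemma mul_div_sqrt_le {a c N β δ : ℝ} (ha : 0 < a) (hc : 0 ≤ c) (hN : 1 ≤ N) (hδ : 0 < δ)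
    (hδ1 : δ ≤ 1) (hβ : β = 576 * N ^ 8 / (δ * min 1 (a ^ 2))) :
    2 * c * N ^ 2 / √β ≤ c * a / 12 := by
  have h1 : 24 * N ^ 4 / a ≤ √β := by
    refine Real.le_sqrt_of_sq_le ?_
    rw [hβ, div_pow, show (24 * N ^ 4) ^ 2 = 576 * N ^ 8 by ring]
    gcongr
    nlinarith [min_le_right 1 (a ^ 2), lt_min one_pos (sq_pos_of_pos ha)]
  have h2 : 0 < 24 * N ^ 4 / a := by positivity
  have hN2 : 1 ≤ N ^ 2 := one_le_pow₀ hN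
  calc _ ≤ 2 * c * N ^ 2 / (24 * N ^ 4 / a) := by gcongr
    _ = c * a / 12 / N ^ 2 := by field_simp; ring
    _ ≤ _ := div_le_self (by positivity) hN2

lemma div_le_of_min {a N β δ : ℝ} (ha : 0 < a) (hN : 1 ≤ N) (hδ : 0 < δ)
    (hβ : β = 576 * N ^ 8 / (δ * min 1 (a ^ 2))) : 576 * N ^ 8 / δ ≤ β := by
  have := lt_min one_pos (sq_pos_of_pos ha)
  rw [hβ]
  gcongr
  exact mul_le_of_le_one_right hδ.le (min_le_left _ _)

end Truncation

end LossDist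

/-! ### The main theorem -/

open LossDist in
set_option maxHeartbeats 1600000 in
theorem mainTheorem9 :
    ∃ c₁ : ℝ, 0 < c₁ ∧
      ∀ (X : Type u) [Fintype X] [MeasurableSpace X] [MeasurableSingletonClass X]
        (ℓ : (X → ℝ) → X → ℝ) (f C D : ℝ → ℝ) (c : ℝ),
        IsInverseLoss ℓ f →
        (∀ z, 1 ≤ z → 0 ≤ f z) →
        MonotoneOn f (Ici 1) →
        ConcaveOn ℝ (Ici 1) f →
        DifferentiableOn ℝ f (Ici 1) →
        (∀ z, 1 ≤ z → f z ≤ c * √z) →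
        MonotoneOn D (Ici 1) →
        (∀ z, 1 ≤ z → derivWithin f (Ici 1) z ≤ D z / z) →
        LeftStronglyConcave f (fun x => C x / x ^ 2) →
        AntitoneOn C (Ici 1) →
        (∀ x, 1 ≤ x → 0 ≤ C x) →
      ∀ p ∈ stdSimplex ℝ X, ∀ (α₁ α₂ : ℝ), ∀ q ∈ approxCalibratedSet p α₁ α₂,
        0 < α₂ →
        α₁ ≤ l1Dist p q ^ 2 / 12 →
        α₂ ≤ l1Dist p q ^ 2 / 12 →
      ∀ (N : ℝ), N = Fintype.card X →
        0 < C (2 * N / α₂) →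
      ∀ (δ : ℝ), 0 < δ → δ ≤ 1 →
      ∀ (β : ℝ),
        β = 576 * N ^ 8 /
          (δ * min 1 ((C (2 * N / α₂) * (l1Dist p q ^ 2 / (128 * c))) ^ 2)) →
      ∀ (m : ℕ), (m : ℝ) ≤ N →
        c₁ * f β ^ 2 * Real.log (1 / δ) / (C (N / (2 * α₂)) * l1Dist p q ^ 2) ^ 2 ≤ m →
      ∀ (Ω : Type v) [MeasurableSpace Ω] (P : Measure Ω) [IsProbabilityMeasure P]
        (S : Fin m → Ω → X), IsIIDSample P S p →
        1 - δ ≤ P.real {ω |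
          expectedLoss ℓ q (empirical fun i => S i ω)
              - expectedLoss ℓ p (empirical fun i => S i ω)
            > C (N / (2 * α₂)) * (l1Dist p q ^ 2 / 384)
              - 2 * α₁ * D (N / (2 * α₂)) - 3 * α₂ * f (N / (3 * α₂))} := by
  classical
  -- The Chernoff bound needs `8 F² log(1/δ) / γ² ≤ m`, used below with `γ = A / 1000`.
  refine ⟨8000000, by norm_num, ?_⟩
  intro X _ _ _ ℓ f C D c hℓ hf0 hm hf hd hfc hDm hD hs hC hC0 p hp α₁ α₂ q hqc hα₂ hα₁l hα₂l
    N hN hC2 δ hδ hδ1 β hβ m hmN hmlog Ω _ P _ S hS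
  obtain ⟨hq, hcal⟩ := hqc
  -- At `δ = 1` the sample-size bound permits `m = 0`, but the claim is trivial.
  rcases hδ1.eq_or_lt with rfl | hδlt
  · simp
  have hcore := hcal.le_sum_mul_sub hp hq hf0 hm hf hd hDm hD hs hC hC0 hα₂ hα₁l hα₂l hN
  have hΔ2 := l1Dist_le_two hp hq
  have hcard : 0 < l1Dist p q → 2 ≤ Fintype.card X := two_le_card_of_l1Dist_pos hp hq
  have hΔn := l1Dist_nonneg p q
  set Δ := l1Dist p q
  have hα₁3 : α₁ ≤ 1 / 3 := by nlinarith
  have hα₂3 : α₂ ≤ 1 / 3 := by nlinarith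
  have hΔ : 0 < Δ := by
    rcases hΔn.eq_or_lt with h | h
    · rw [← h] at hα₂l; norm_num at hα₂l; linarith
    · exact h
  have hN2 : 2 ≤ N := by rw [hN]; exact_mod_cast hcard hΔ
  have hE2 : 2 ≤ N / (2 * α₂) := by rw [le_div_iff₀ (by positivity)]; linarith
  have hE1 : 1 ≤ N / (2 * α₂) := one_le_two.trans hE2
  have hCE : C (2 * N / α₂) ≤ C (N / (2 * α₂)) := by
    have h1 : N / (2 * α₂) ≤ 2 * N / α₂ := by
      rw [div_le_div_iff₀ (by positivity) hα₂]; nlinarith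
    exact hC hE1 (hE1.trans h1) h1
  set E := N / (2 * α₂) with hE
  have hf2 : C E / 8 ≤ f 2 := by
    have := hs.div_eight_le hd hm (hf0 1 le_rfl)
    have := hC (mem_Ici.2 one_le_two) hE1 hE2
    linarith
  have hCEpos : 0 < C E := hC2.trans_le hCE
  have hc : 0 < c := by
    have h1 := hfc 2 one_le_two
    exact pos_of_mul_pos_left (by linarith) (Real.sqrt_nonneg 2)
  obtain ⟨hα₁, -⟩ := hcal.exists_levels hp hq (by linarith)
  have hDE : 0 ≤ D E := by
    have := (hm.derivWithin_nonneg (x := E)).trans (hD E hE1)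
    rw [le_div_iff₀ (by linarith), zero_mul] at this
    exact this
  have hqpos : ∀ x, 0 < p x → 0 < q x := fun x => hcal.pos_of_pos hp hq (by linarith)
  have hpq : ∀ x, 2 / 3 * p x ≤ N * q x := fun x => by
    have := hcal.mul_le_card_mul hp hq (by linarith) x
    rw [← hN] at this
    nlinarith [hp.1 x]
  set A := C E * Δ ^ 2 with hA
  have hApos : 0 < A := by positivity
  set a := C (2 * N / α₂) * (Δ ^ 2 / (128 * c)) with ha
  have hapos : 0 < a := by positivity
  have hsmall : 2 * c * N ^ 2 / √β ≤ A / 1536 := by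
    refine (mul_div_sqrt_le hapos hc.le (by linarith) hδ hδ1 hβ).trans ?_
    have h1 : c * a / 12 = C (2 * N / α₂) * Δ ^ 2 / 1536 := by
      rw [ha]; field_simp; ring
    rw [h1, hA]
    gcongr
  have hβN : 576 * N ^ 8 / δ ≤ β := div_le_of_min hapos (by linarith) hδ hβ
  have hN8 : N ^ 3 * 32 ≤ N ^ 8 := by
    have : (2 : ℝ) ^ 5 ≤ N ^ 5 := by gcongr
    calc N ^ 3 * 32 ≤ N ^ 3 * N ^ 5 := by gcongr; linarith
      _ = N ^ 8 := by ring
  have hβδ : 576 * N ^ 8 ≤ β * δ := (div_le_iff₀ hδ).1 hβN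
  have hN3 : (2 : ℝ) ^ 3 ≤ N ^ 3 := by gcongr
  have hβpos : 0 < β := lt_of_lt_of_le (by positivity) hβN
  have hβ2 : 2 ≤ β := by nlinarith
  have hFpos : C E / 8 ≤ f β := hf2.trans (hm (mem_Ici.2 one_le_two)
    (mem_Ici.2 (one_le_two.trans hβ2)) hβ2)
  have hF0 : 0 < f β := by linarith
  have hFc := hfc β (by linarith)
  set F := f β
  set Y : X → ℝ := fun x => ℓ q x - ℓ p x with hY
  have hYf : ∀ x, p x * Y x = p x * (f (1 / q x) - f (1 / p x)) := by
    intro x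
    rcases (hp.1 x).eq_or_lt with h0 | h0
    · simp [← h0]
    · rw [hY]; simp only; rw [hℓ q hq x (hqpos x h0), hℓ p hp x h0]
  set G := Finset.univ.filter fun x => 2 * N / β ≤ p x
  set B := Finset.univ.filter fun x => ¬ 2 * N / β ≤ p x
  have hsplit : ∀ φ : X → ℝ, ∑ x ∈ G, φ x + ∑ x ∈ B, φ x = ∑ x, φ x := fun φ =>
    Finset.sum_filter_add_sum_filter_not _ _ _
  have hBlt : ∀ x ∈ B, p x < 2 * N / β := fun x hx => not_le.1 (Finset.mem_filter.1 hx).2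
  have hbad := sum_mul_sub_le_of_lt hf0 hfc hc.le hβpos hN hp hq hpq B hBlt
  have hpB : ∑ x ∈ B, p x ≤ 2 * N ^ 2 / β := by
    calc ∑ x ∈ B, p x ≤ B.card * (2 * N / β) := by
          rw [← nsmul_eq_mul]
          exact Finset.sum_le_card_nsmul _ _ _ fun x hx => (hBlt x hx).le
      _ ≤ N * (2 * N / β) := by
          refine mul_le_mul_of_nonneg_right ?_ (by positivity)
          rw [hN]
          exact_mod_cast Finset.card_le_univ _
      _ = _ := by ring
  have hg := hsplit p
  rw [hp.2] at hg
  have hpB0 : 0 ≤ ∑ x ∈ B, p x := Finset.sum_nonneg fun x _ => hp.1 x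
  have hYF : ∀ x ∈ G, |Y x| ≤ F := by
    intro x hx
    have hxθ := (Finset.mem_filter.1 hx).2
    have hx0 : 0 < p x := lt_of_lt_of_le (by positivity) hxθ
    have hq0 := hqpos x hx0
    have h1 := (div_le_iff₀ hβpos).1 hxθ
    have hrange : ∀ r : ℝ, 0 < r → r ≤ 1 → 1 ≤ β * r → 0 ≤ f (1 / r) ∧ f (1 / r) ≤ F := by
      intro r hr hr1 hrβ
      have h2 : 1 ≤ 1 / r := (one_le_div hr).2 hr1
      have h3 : 1 / r ≤ β := (div_le_iff₀ hr).2 hrβ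
      exact ⟨hf0 _ h2, hm h2 (h2.trans h3) h3⟩
    have h4 := hrange (p x) hx0 (stdSimplex_le_one hp x) (by nlinarith)
    have h5 := hrange (q x) hq0 (stdSimplex_le_one hq x) (by
      have h6 := mul_le_mul_of_nonneg_left (hpq x) hβpos.le
      have h7 : N * 1 ≤ N * (β * q x) := by nlinarith
      exact le_of_mul_le_mul_left h7 (by linarith))
    have hYx : Y x = f (1 / q x) - f (1 / p x) := mul_left_cancel₀ hx0.ne' (hYf x)
    rw [hYx, abs_le]
    constructor <;> linarith [h4.1, h4.2, h5.1, h5.2]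
  set t := C E * (Δ ^ 2 / 384) - 2 * α₁ * D E - 3 * α₂ * f (N / (3 * α₂)) with ht
  -- Budget: `1/384 + 1/1000 + 2/1536 < 1/200`. One `A / 1536` pays for the discarded points, the
  -- other for the factor `∑ x ∈ G, p x` in `hM` when `t + A / 1000` is negative.
  have hmean : t + A / 1000 + A / 1536 ≤ ∑ x ∈ G, p x * Y x := by
    have h1 := hsplit fun x => p x * Y x
    simp only [hYf] at h1 ⊢
    have h2 := mul_nonneg hα₁ hDE
    linarith
  have hM : (∑ x ∈ G, p x) * (t + A / 1000) ≤ ∑ x ∈ G, p x * Y x := by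
    have hg0 : 0 ≤ ∑ x ∈ G, p x := Finset.sum_nonneg fun x _ => hp.1 x
    rcases le_or_gt (t + A / 1000) (-F) with h | h
    · calc _ ≤ (∑ x ∈ G, p x) * (-F) := by gcongr
        _ ≤ _ := by
          rw [Finset.sum_mul]
          exact Finset.sum_le_sum fun x hx =>
            mul_le_mul_of_nonneg_left (abs_le.1 (hYF x hx)).1 (hp.1 x)
    · have h1 : (∑ x ∈ B, p x) * F ≤ A / 1536 := by
        refine le_trans ?_ hsmall
        calc (∑ x ∈ B, p x) * F ≤ 2 * N ^ 2 / β * (c * √β) := by gcongr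
          _ = 2 * c * N ^ 2 * (√β / β) := by ring
          _ = _ := by rw [Real.sqrt_div_self', mul_one_div]
      have h2 : (∑ x ∈ G, p x) = 1 - ∑ x ∈ B, p x := by linarith
      rw [h2]
      nlinarith
  have hm0 : 0 < m := by
    have hlog : 0 < Real.log (1 / δ) := Real.log_pos ((one_lt_div hδ).2 hδlt)
    have : (0 : ℝ) < m := lt_of_lt_of_le (by positivity) hmlog
    exact_mod_cast this
  have hA4 : A ≤ C E * 4 := by
    rw [hA]
    gcongr
    nlinarith
  have hfinal := hS.one_sub_le_measureReal_lt G hp.1 hF0 hYF (γ := A / 1000) (by positivity)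
    (by linarith) hM hm0 hδ hδ1 (by
      have h1 : 1 - ∑ x ∈ G, p x = ∑ x ∈ B, p x := by linarith
      rw [h1]
      calc (m : ℝ) * ∑ x ∈ B, p x ≤ N * (2 * N ^ 2 / β) := by gcongr
        _ = 2 * N ^ 3 / β := by ring
        _ ≤ δ / 4 := by
          rw [div_le_div_iff₀ hβpos (by norm_num)]
          nlinarith) (by
      refine le_trans (le_of_eq ?_) hmlog
      field_simp
      ring)
  convert hfinal using 4 with ω
  rw [expectedLoss_empirical, expectedLoss_empirical, ← sub_div, ← Finset.sum_sub_distrib]
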